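/- Let $d\ge 1$ be odd and $m\ge 3$. Let $E=P^m(\mathbb R^d)_0^{S_d}$ be the finite-dimensional real vector space, with its usual topology, of polynomials $p:\mathbb R^d\to\mathbb R$ of degree at most $m$ that are invariant under all permutations of the coordinates and satisfy $p(0)=0$ and $Dp(0)=0$. For $p\in E$, an eigenspace $W\subseteq\mathbb R^d$ of $D^2p(0)$, and $\eta\in\mathbb R$, put $F_{W,\eta}:W\to W$, $F_{W,\eta}(x)=\pi_W\big(D^3p(0)(x,x,\cdot)\big)-\eta x$, where linear forms are identified with vectors by the Euclidean inner product and $\pi_W$ is the orthogonal projection onto $W$. The number $\eta$ is an eigenvalue of $D^3p(0)$ restricted to $W$ if $F_{W,\eta}(x)=0$ for some unit vector $x\in W$, and it is regular if the derivative $DF_{W,\eta}(x):W\to W$ is onto for every unit vector $x\in W$ with $F_{W,\eta}(x)=0$. The polynomial $p$ satisfies Property C if, for every eigenspace $W$ of $D^2p(0)$, every eigenvalue of $D^3p(0)$ restricted to $W$ is regular. Then the set of all $p\in E$ that satisfy Property C and, if $d>1$, whose Hessian $D^2p(0)$ has two distinct eigenvalues (that is, is not a multiple of the identity), is open and dense in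 $E$. Moreover, the polynomial $h_d(x)=\sum_{i<j}x_ix_j+\frac13\sum_i x_i^3$ belongs to $E$ and satisfies Property C. -/

import Mathlib

namespace TangencyPropC

open MvPolynomial

/-- `P^m(ℝ^d)_0^{S_d}`: the real polynomials in `d` variables of degree at most `m` that are
invariant under all permutations of the coordinates and vanish to first order at the origin
(value and gradient are zero there). -/
noncomputable def invariantPolys (d m : ℕ) : Submodule ℝ (MvPolynomial (Fin d) ℝ) where
  carrier := {p | p.totalDegree ≤ m ∧ p.IsSymmetric ∧ eval 0 p = 0 ∧
    ∀ i, eval 0 (pderiv i p) = 0}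
  zero_mem' := by
    refine ⟨by simp, fun e => by simp, by simp, fun i => by simp⟩
  add_mem' := by
    rintro p q ⟨hp1, hp2, hp3, hp4⟩ ⟨hq1, hq2, hq3, hq4⟩
    refine ⟨(totalDegree_add p q).trans (max_le hp1 hq1), hp2.add hq2, by rw [map_add, hp3, hq3, add_zero],
      fun i => by rw [map_add, map_add, hp4 i, hq4 i, add_zero]⟩
  smul_mem' := by
    rintro c p ⟨hp1, hp2, hp3, hp4⟩
    refine ⟨(totalDegree_smul_le c p).trans hp1, hp2.smul c, by rw [smul_eval, hp3, mul_zero],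
      fun i => by rw [Derivation.map_smul, smul_eval, hp4 i, mul_zero]⟩

/-- The topology of this finite-dimensional real vector space: convergence of coefficients. -/
instance (d m : ℕ) : TopologicalSpace (invariantPolys d m) :=
  TopologicalSpace.induced
    (fun (p : invariantPolys d m) (s : Fin d →₀ ℕ) => coeff s (p : MvPolynomial (Fin d) ℝ))
    inferInstance

variable {d : ℕ}

/-- The symmetric linear map of `ℝ^d` given by the Hessian matrix `D²p(0)`. -/
noncomputable def hessian (p : MvPolynomial (Fin d) ℝ) :
    EuclideanSpace ℝ (Fin d) →ₗ[ℝ] EuclideanSpace ℝ (Fin d) :=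
  Matrix.toEuclideanLin (Matrix.of fun i j => eval 0 (pderiv i (pderiv j p)))

/-- The vector `D³p(0)(x, x, ·)`, under the identification of linear forms with vectors by the
Euclidean inner product. -/
noncomputable def thirdDeriv (p : MvPolynomial (Fin d) ℝ) (x : EuclideanSpace ℝ (Fin d)) :
    EuclideanSpace ℝ (Fin d) :=
  WithLp.toLp 2 fun i => ∑ j, ∑ k, eval 0 (pderiv i (pderiv j (pderiv k p))) * x j * x k

/-- The map `x ↦ T x² - η x` of `W` into itself, where `T` is the restriction of the symmetric
trilinear form `D³p(0)` to the subspace `W`; the linear form `T(x, x, ·)` on `W` is represented by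
the orthogonal projection of `D³p(0)(x, x, ·)` to `W`. -/
noncomputable def eigenMap (p : MvPolynomial (Fin d) ℝ)
    (W : Submodule ℝ (EuclideanSpace ℝ (Fin d))) (η : ℝ) (x : W) : W :=
  W.orthogonalProjectionOnto (thirdDeriv p x) - η • x

/-- `η` is an eigenvalue of the restriction of `D³p(0)` to `W`, with a unit eigenvector. -/
def IsTensorEigenvalue (p : MvPolynomial (Fin d) ℝ)
    (W : Submodule ℝ (EuclideanSpace ℝ (Fin d))) (η : ℝ) : Prop :=
  ∃ x : W, ‖x‖ = 1 ∧ eigenMap p W η x = 0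

/-- `η` is regular for the restriction of `D³p(0)` to `W`: the derivative of
`x ↦ T x² - η x`, as a map of `W` into `W`, is onto at each of its zeros on the unit sphere. -/
def IsRegularEigenvalue (p : MvPolynomial (Fin d) ℝ)
    (W : Submodule ℝ (EuclideanSpace ℝ (Fin d))) (η : ℝ) : Prop :=
  ∀ x : W, ‖x‖ = 1 → eigenMap p W η x = 0 →
    Function.Surjective (fderiv ℝ (eigenMap p W η) x)

/-- Property C: every eigenvalue of `D³p(0)` restricted to an eigenspace of `D²p(0)` is regular. -/
def PropertyC (p : MvPolynomial (Fin d) ℝ) : Prop :=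
  ∀ μ : ℝ, Module.End.HasEigenvalue (hessian p) μ →
    ∀ η : ℝ, IsTensorEigenvalue p (Module.End.eigenspace (hessian p) μ) η →
      IsRegularEigenvalue p (Module.End.eigenspace (hessian p) μ) η

/-- `D²p(0)` is not a multiple of the identity: it has two different eigenvalues. -/
def HasDistinctHessianEigenvalues (p : MvPolynomial (Fin d) ℝ) : Prop :=
  ∃ μ ν : ℝ, μ ≠ ν ∧ Module.End.HasEigenvalue (hessian p) μ ∧
    Module.End.HasEigenvalue (hessian p) ν

/-- `h_d = ∑_{i<j} x_i x_j + (1/3) ∑ x_i³`. -/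
noncomputable def witness (d : ℕ) : MvPolynomial (Fin d) ℝ :=
  (∑ i, ∑ j ∈ Finset.Ioi i, X i * X j) + C (1 / 3) * (∑ i, X i ^ 3)

end TangencyPropC

namespace TangencyPropC

open MvPolynomial

variable {d : ℕ}

/-! Invariance forces `D²p(0) = a I + b J` (`J` the all-ones matrix) and a cubic form governed by
three numbers `A`, `B`, `G` (`exists_invariantForm`), all linear in `p`. For `d > 1` and `b ≠ 0` the
eigenspaces are the diagonal line and the zero-sum hyperplane. On the line the cubic form is
multiplication by `c = A + 3dB + d²G`, regular iff `c ≠ 0`. On the hyperplane the `B` and `G` terms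
vanish up to constant vectors, which are orthogonal to it, so only `A x_i²` remains; for odd `d`
this is regular iff `A ≠ 0` (`eq_zero_of_sum_eq_zero`).

Hence the set in question is cut out by the nonvanishing of `c` and, if `d > 1`, of `b` and `A`
(`propertyC_and_distinct_iff`). These are continuous linear functionals, which gives openness; none
vanishes at `h_d`, so `p + t h_d` lies in the set for all small `t ≠ 0`, which gives density. -/

/-- Partial derivatives of polynomials commute. -/
theorem pderiv_comm (i j : Fin d) (p : MvPolynomial (Fin d) ℝ) :
    pderiv i (pderiv j p) = pderiv j (pderiv i p) := by
  ext m
  rw [coeff_pderiv, coeff_pderiv, coeff_pderiv, coeff_pderiv, add_right_comm]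
  rcases eq_or_ne i j with rfl | h
  · rfl
  · simp [h, h.symm]
    ring

/-! ### Regularity as injectivity of the derivative -/

/-- The vector `D³p(0)(x, y, ·)`. -/
noncomputable def thirdMixed (p : MvPolynomial (Fin d) ℝ) (x y : EuclideanSpace ℝ (Fin d)) :
    EuclideanSpace ℝ (Fin d) :=
  WithLp.toLp 2 fun i => ∑ j, ∑ k, eval 0 (pderiv i (pderiv j (pderiv k p))) * x j * y k

theorem thirdDeriv_add_smul (p : MvPolynomial (Fin d) ℝ) (x v : EuclideanSpace ℝ (Fin d)) (t : ℝ) :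
    thirdDeriv p (x + t • v) =
      thirdDeriv p x + t • ((2 : ℝ) • thirdMixed p x v) + t ^ 2 • thirdDeriv p v := by
  have hsymm : ∀ i, ∑ j, ∑ k, eval 0 (pderiv i (pderiv j (pderiv k p))) * v j * x k =
      ∑ j, ∑ k, eval 0 (pderiv i (pderiv j (pderiv k p))) * x j * v k := by
    intro i
    rw [Finset.sum_comm]
    refine Finset.sum_congr rfl fun j _ => Finset.sum_congr rfl fun k _ => ?_
    rw [pderiv_comm k j]
    ring
  ext i
  have h2 : (2 : ℝ) * ∑ j, ∑ k, eval 0 (pderiv i (pderiv j (pderiv k p))) * x j * v k =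
      ∑ j, ∑ k, (eval 0 (pderiv i (pderiv j (pderiv k p))) * x j * v k +
        eval 0 (pderiv i (pderiv j (pderiv k p))) * v j * x k) := by
    simp only [Finset.sum_add_distrib]
    rw [hsymm i]
    ring
  simp only [thirdDeriv, thirdMixed, PiLp.add_apply, PiLp.smul_apply, smul_eq_mul]
  rw [h2]
  simp only [Finset.mul_sum, ← Finset.sum_add_distrib]
  refine Finset.sum_congr rfl fun j _ => Finset.sum_congr rfl fun k _ => ?_
  ring

theorem differentiable_thirdDeriv (p : MvPolynomial (Fin d) ℝ) :
    Differentiable ℝ (thirdDeriv p) := by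
  rw [differentiable_euclidean]
  intro i
  simp only [thirdDeriv]
  fun_prop

theorem fderiv_eigenMap_apply (p : MvPolynomial (Fin d) ℝ)
    (W : Submodule ℝ (EuclideanSpace ℝ (Fin d))) (η : ℝ) (x v : W) :
    fderiv ℝ (eigenMap p W η) x v =
      W.orthogonalProjectionOnto ((2 : ℝ) • thirdMixed p x v) - η • v := by
  have hd : DifferentiableAt ℝ (eigenMap p W η) x := by
    have h := differentiable_thirdDeriv p
    unfold eigenMap
    have h' : Differentiable ℝ fun y : W => thirdDeriv p y := h.comp W.subtypeL.differentiable
    have h'' : Differentiable ℝ fun y : W => W.orthogonalProjectionOnto (thirdDeriv p y) :=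
      W.orthogonalProjectionOnto.differentiable.comp h'
    exact (h''.sub (differentiable_id.const_smul η)) x
  rw [← hd.lineDeriv_eq_fderiv]
  have key : (fun t : ℝ => eigenMap p W η (x + t • v)) = fun t : ℝ => eigenMap p W η x +
      t • (W.orthogonalProjectionOnto ((2 : ℝ) • thirdMixed p x v) - η • v) +
      t ^ 2 • W.orthogonalProjectionOnto (thirdDeriv p v) := by
    ext1 t
    simp only [eigenMap, Submodule.coe_add, Submodule.coe_smul, thirdDeriv_add_smul, map_add,
      map_smul]
    module
  unfold lineDeriv
  rw [key]
  have h1 := ((hasDerivAt_id (0 : ℝ)).smul_const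
    (W.orthogonalProjectionOnto ((2 : ℝ) • thirdMixed p x v) - η • v)).const_add (eigenMap p W η x)
  have h2 := (hasDerivAt_pow 2 (0 : ℝ)).smul_const (W.orthogonalProjectionOnto (thirdDeriv p v))
  refine (h1.add h2).deriv.trans ?_
  simp

theorem orthogonalProjectionOnto_sub_smul_eq_zero_iff
    (W : Submodule ℝ (EuclideanSpace ℝ (Fin d))) (y : EuclideanSpace ℝ (Fin d)) (η : ℝ) (x : W) :
    W.orthogonalProjectionOnto y - η • x = 0 ↔ y - η • (x : EuclideanSpace ℝ (Fin d)) ∈ Wᗮ := by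
  rw [← Submodule.orthogonalProjectionOnto_eq_zero_iff, map_sub, map_smul,
    Submodule.orthogonalProjectionOnto_mem_subspace_eq_self]

/-- In finite dimension onto and injective agree for an endomorphism, so regularity becomes a kernel
condition. -/
theorem surjective_fderiv_eigenMap_iff (p : MvPolynomial (Fin d) ℝ)
    (W : Submodule ℝ (EuclideanSpace ℝ (Fin d))) (η : ℝ) (x : W) :
    Function.Surjective (fderiv ℝ (eigenMap p W η) x) ↔
      ∀ v ∈ W, (2 : ℝ) • thirdMixed p x v - η • v ∈ Wᗮ → v = 0 := by
  have h := LinearMap.injective_iff_surjective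
    (f := (fderiv ℝ (eigenMap p W η) x : W →ₗ[ℝ] W))
  rw [ContinuousLinearMap.coe_coe] at h
  rw [← h, ← ContinuousLinearMap.coe_coe, injective_iff_map_eq_zero]
  simp only [ContinuousLinearMap.coe_coe, fderiv_eigenMap_apply,
    orthogonalProjectionOnto_sub_smul_eq_zero_iff, Subtype.forall, Submodule.mk_eq_zero]

theorem propertyC_iff (p : MvPolynomial (Fin d) ℝ) :
    PropertyC p ↔ ∀ μ, Module.End.HasEigenvalue (hessian p) μ → ∀ η : ℝ,
      ∀ x ∈ Module.End.eigenspace (hessian p) μ, ‖x‖ = 1 →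
        thirdDeriv p x - η • x ∈ (Module.End.eigenspace (hessian p) μ)ᗮ →
        ∀ v ∈ Module.End.eigenspace (hessian p) μ,
          (2 : ℝ) • thirdMixed p x v - η • v ∈ (Module.End.eigenspace (hessian p) μ)ᗮ → v = 0 := by
  constructor
  · intro h μ hμ η x hx hx1 hx2
    have hz := (orthogonalProjectionOnto_sub_smul_eq_zero_iff _ _ η ⟨x, hx⟩).2 hx2
    exact (surjective_fderiv_eigenMap_iff p _ η ⟨x, hx⟩).1
      (h μ hμ η ⟨⟨x, hx⟩, hx1, hz⟩ ⟨x, hx⟩ hx1 hz)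
  · intro h μ hμ η _ x hx1 hx2
    exact (surjective_fderiv_eigenMap_iff p _ η x).2 (h μ hμ η x x.2 hx1
      ((orthogonalProjectionOnto_sub_smul_eq_zero_iff _ _ η x).1 hx2))

/-- A nonzero vector annihilated by the restricted tensor violates Property C. -/
theorem PropertyC.thirdDeriv_notMem_orthogonal {p : MvPolynomial (Fin d) ℝ} (hp : PropertyC p)
    {μ : ℝ} {x : EuclideanSpace ℝ (Fin d)} (hx : x ∈ Module.End.eigenspace (hessian p) μ)
    (hx0 : x ≠ 0) : thirdDeriv p x ∉ (Module.End.eigenspace (hessian p) μ)ᗮ := by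
  intro hT
  have hn : ‖x‖ ≠ 0 := norm_ne_zero_iff.2 hx0
  have hsc : ∀ t : ℝ, thirdDeriv p (t • x) = t ^ 2 • thirdDeriv p x := fun t => by
    have h := thirdDeriv_add_smul p 0 x t
    have h0 : thirdDeriv p 0 = 0 := by ext i; simp [thirdDeriv]
    have h1 : thirdMixed p 0 x = 0 := by ext i; simp [thirdMixed]
    simpa [h0, h1] using h
  have hsq : ∀ y, thirdMixed p y y = thirdDeriv p y := fun y => rfl
  have hmem := Submodule.smul_mem _ (‖x‖⁻¹ ^ 2) hT
  rw [← hsc] at hmem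
  -- The normalised vector is an eigenvector for `η = 0` and lies in the kernel of the derivative
  -- there, since `2 T(x, x, ·)` vanishes on `W`.
  have := (propertyC_iff p).1 hp μ (Module.End.hasEigenvalue_of_hasEigenvector ⟨hx, hx0⟩) 0
    (‖x‖⁻¹ • x) (Submodule.smul_mem _ _ hx) (by rw [norm_smul, norm_inv, norm_norm,
      inv_mul_cancel₀ hn]) (by simpa using hmem)
    (‖x‖⁻¹ • x) (Submodule.smul_mem _ _ hx)
    (by rw [hsq, zero_smul, sub_zero]; exact Submodule.smul_mem _ _ hmem)
  simp [hx0] at this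

/-! ### The invariant form and its eigenspaces -/

/-- The shape of the second and third derivatives at the origin of a symmetric polynomial. -/
structure HasInvariantForm (p : MvPolynomial (Fin d) ℝ) (a b A B G : ℝ) : Prop where
  second : ∀ i j, eval 0 (pderiv i (pderiv j p)) = (if i = j then a else 0) + b
  third : ∀ i j k, eval 0 (pderiv i (pderiv j (pderiv k p))) =
    A * ((if i = j then 1 else 0) * (if i = k then 1 else 0)) +
      B * ((if i = j then 1 else 0) + (if i = k then 1 else 0) + (if j = k then 1 else 0)) + G

namespace HasInvariantForm

variable {p : MvPolynomial (Fin d) ℝ} {a b A B G : ℝ}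

theorem hessian_apply (h : HasInvariantForm p a b A B G) (x : EuclideanSpace ℝ (Fin d))
    (i : Fin d) : hessian p x i = a * x i + b * ∑ j, x j := by
  simp only [hessian, Matrix.toLpLin_apply, Matrix.mulVec, dotProduct, Matrix.of_apply, h.second,
    add_mul, Finset.sum_add_distrib, ite_mul, zero_mul, Finset.sum_ite_eq, Finset.mem_univ, if_true,
    Finset.mul_sum]

theorem thirdMixed_apply (h : HasInvariantForm p a b A B G) (x y : EuclideanSpace ℝ (Fin d))
    (i : Fin d) : thirdMixed p x y i = A * (x i * y i) +
      B * (x i * ∑ j, y j + y i * ∑ j, x j + ∑ j, x j * y j) + G * ((∑ j, x j) * ∑ j, y j) := by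
  have hterm : ∀ j k, eval 0 (pderiv i (pderiv j (pderiv k p))) * x j * y k =
      (if i = j then (if i = k then A * (x j * y k) else 0) else 0) +
      (if i = j then B * (x j * y k) else 0) + (if i = k then B * (x j * y k) else 0) +
      (if j = k then B * (x j * y k) else 0) + G * (x j * y k) := by
    intro j k
    rw [h.third]
    split_ifs <;> ring
  simp only [thirdMixed, hterm, Finset.sum_add_distrib]
  rw [Finset.sum_mul_sum]
  simp only [Finset.sum_ite_eq, Finset.mem_univ, if_true, Finset.sum_ite_irrel,
    Finset.sum_const_zero, ← Finset.mul_sum, ← Finset.sum_mul]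
  ring

theorem thirdDeriv_apply (h : HasInvariantForm p a b A B G) (x : EuclideanSpace ℝ (Fin d))
    (i : Fin d) : thirdDeriv p x i = A * (x i * x i) +
      B * (x i * ∑ j, x j + x i * ∑ j, x j + ∑ j, x j * x j) + G * ((∑ j, x j) * ∑ j, x j) :=
  h.thirdMixed_apply x x i

theorem mem_eigenspace_iff (h : HasInvariantForm p a b A B G) {μ : ℝ}
    {x : EuclideanSpace ℝ (Fin d)} :
    x ∈ Module.End.eigenspace (hessian p) μ ↔ ∀ i, a * x i + b * ∑ j, x j = μ * x i := by
  rw [Module.End.mem_eigenspace_iff, PiLp.ext_iff]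
  simp only [h.hessian_apply, PiLp.smul_apply, smul_eq_mul]

theorem mem_eigenspace_self_iff (h : HasInvariantForm p a b A B G) (hb : b ≠ 0) (hd : 0 < d)
    {x : EuclideanSpace ℝ (Fin d)} :
    x ∈ Module.End.eigenspace (hessian p) a ↔ ∑ j, x j = 0 := by
  rw [h.mem_eigenspace_iff]
  refine ⟨fun hx => ?_, fun hx i => by rw [hx, mul_zero, add_zero]⟩
  simpa [hb] using hx ⟨0, hd⟩

theorem const_mem_eigenspace (h : HasInvariantForm p a b A B G) (t : ℝ) :
    WithLp.toLp 2 (fun _ => t) ∈ Module.End.eigenspace (hessian p) (a + d * b) := by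
  rw [h.mem_eigenspace_iff]
  intro i
  simp
  ring

theorem sub_single_mem_eigenspace (h : HasInvariantForm p a b A B G) (i j : Fin d) :
    EuclideanSpace.single i (1 : ℝ) - EuclideanSpace.single j 1 ∈
      Module.End.eigenspace (hessian p) a := by
  rw [h.mem_eigenspace_iff]
  intro k
  simp [Finset.sum_sub_distrib]

end HasInvariantForm

theorem single_sub_single_ne_zero {i j : Fin d} (hij : i ≠ j) :
    EuclideanSpace.single i (1 : ℝ) - EuclideanSpace.single j 1 ≠ 0 := by
  intro h
  have := congrArg (fun v : EuclideanSpace ℝ (Fin d) => v i) h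
  simp [hij] at this

/-- An odd number of reals with equal squares and zero sum vanish. -/
theorem eq_zero_of_sq_const_of_sum_eq_zero (hd : Odd d) {x : Fin d → ℝ} {r : ℝ}
    (hx : ∀ i, x i ^ 2 = r) (hs : ∑ i, x i = 0) (i : Fin d) : x i = 0 := by
  by_contra hi
  have hpm : ∀ j, x j = x i ∨ x j = -x i := fun j =>
    sq_eq_sq_iff_eq_or_eq_neg.1 ((hx j).trans (hx i).symm)
  let ε : Fin d → ℤ := fun j => if x j = x i then 1 else -1
  have hε : ∀ j, x j = ε j * x i := by
    intro j
    by_cases h : x j = x i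
    · simp [ε, h]
    · simpa [ε, h] using (hpm j).resolve_left h
  have hsum : (∑ j, ε j : ℤ) = 0 := by
    have : ((∑ j, ε j : ℤ) : ℝ) * x i = 0 := by
      rw [Int.cast_sum, Finset.sum_mul, ← hs]
      exact Finset.sum_congr rfl fun j _ => (hε j).symm
    exact_mod_cast (mul_eq_zero.1 this).resolve_right hi
  -- Every sign is `1` modulo 2, so a sum of `d` signs has the parity of `d`.
  have hmod : ((∑ j, ε j : ℤ) : ZMod 2) = d := by
    have h1 : ∀ j, ((ε j : ℤ) : ZMod 2) = 1 := by
      intro j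
      by_cases h : x j = x i
      · simp [ε, h]
      · simp only [ε, h, if_false]
        decide
    simp [h1]
  rw [hsum, (ZMod.natCast_eq_one_iff_odd).2 hd] at hmod
  simp at hmod

/-- Vectors orthogonal to all vectors of zero sum have equal coordinates. -/
theorem eq_of_mem_orthogonal {W : Submodule ℝ (EuclideanSpace ℝ (Fin d))}
    (hW : ∀ x, ∑ i, x i = 0 → x ∈ W) {y : EuclideanSpace ℝ (Fin d)} (hy : y ∈ Wᗮ)
    (i j : Fin d) : y i = y j := by
  have hmem : EuclideanSpace.single i (1 : ℝ) - EuclideanSpace.single j 1 ∈ W :=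
    hW _ (by simp [Finset.sum_sub_distrib])
  have := (Submodule.mem_orthogonal _ _).1 hy _ hmem
  simpa [inner_sub_left, EuclideanSpace.inner_single_left, sub_eq_zero] using this

/-! ### Property C in terms of `b`, `A`, `B`, `G` -/

namespace HasInvariantForm

variable {p : MvPolynomial (Fin d) ℝ} {a b A B G : ℝ}

/-- Regularity on a space of vectors with equal coordinates. -/
theorem eq_zero_of_const (h : HasInvariantForm p a b A B G) (hc : A + 3 * d * B + d ^ 2 * G ≠ 0)
    {W : Submodule ℝ (EuclideanSpace ℝ (Fin d))} (hW : ∀ x ∈ W, ∀ i j, x i = x j)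
    {η : ℝ} {x v : EuclideanSpace ℝ (Fin d)} (hx : x ∈ W) (hx1 : ‖x‖ = 1)
    (hxT : thirdDeriv p x - η • x ∈ Wᗮ) (hv : v ∈ W)
    (hvT : (2 : ℝ) • thirdMixed p x v - η • v ∈ Wᗮ) : v = 0 := by
  have hx0 : x ≠ 0 := norm_ne_zero_iff.1 (by rw [hx1]; norm_num)
  obtain ⟨i, hi⟩ : ∃ i, x i ≠ 0 := by
    by_contra! hcon
    exact hx0 (PiLp.ext hcon)
  have hmix : ∀ w ∈ W, thirdMixed p x w = ((A + 3 * d * B + d ^ 2 * G) * w i) • x := by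
    intro w hw
    have hxs : ∀ j, x j = x i := fun j => hW x hx j i
    have hws : ∀ j, w j = w i := fun j => hW w hw j i
    ext k
    rw [h.thirdMixed_apply]
    simp [hxs, hws]
    ring
  have hsub : ∀ t : ℝ, t • x ∈ Wᗮ → t = 0 := by
    intro t ht
    have h0 := (Submodule.mem_orthogonal _ _).1 ht x hx
    rw [inner_smul_right, real_inner_self_eq_norm_sq, hx1] at h0
    simpa using h0
  have hvx : v = (v i / x i) • x := by
    ext k
    simp only [PiLp.smul_apply, smul_eq_mul]
    rw [hW x hx k i, div_mul_cancel₀ _ hi]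
    exact hW v hv k i
  have h1 : (A + 3 * d * B + d ^ 2 * G) * x i - η = 0 := by
    apply hsub
    rw [sub_smul, ← hmix x hx]
    exact hxT
  have h2 : 2 * ((A + 3 * d * B + d ^ 2 * G) * v i) - η * (v i / x i) = 0 := by
    apply hsub
    rw [sub_smul, mul_smul 2, mul_smul η, ← hvx, ← hmix v hv]
    exact hvT
  -- With this `η` the derivative `2 c x_i - η` equals `c x_i`, which is nonzero.
  have hη : η = (A + 3 * d * B + d ^ 2 * G) * x i := by linarith
  have h3 : (A + 3 * d * B + d ^ 2 * G) * v i = 0 := by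
    rw [hη] at h2
    field_simp at h2
    linarith
  have hvi : v i = 0 := (mul_eq_zero.1 h3).resolve_left hc
  rw [hvx, hvi, zero_div, zero_smul]

/-- Regularity on the space of vectors of zero sum; this is where the parity of `d` enters. -/
theorem eq_zero_of_sum_eq_zero (h : HasInvariantForm p a b A B G) (hd : Odd d) (hA : A ≠ 0)
    {W : Submodule ℝ (EuclideanSpace ℝ (Fin d))} (hW : ∀ x, x ∈ W ↔ ∑ i, x i = 0)
    {η : ℝ} {x v : EuclideanSpace ℝ (Fin d)} (hx : x ∈ W) (hx1 : ‖x‖ = 1)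
    (hxT : thirdDeriv p x - η • x ∈ Wᗮ) (hv : v ∈ W)
    (hvT : (2 : ℝ) • thirdMixed p x v - η • v ∈ Wᗮ) : v = 0 := by
  have hd0 : (d : ℝ) ≠ 0 := Nat.cast_ne_zero.2 hd.pos.ne'
  let o : Fin d := ⟨0, hd.pos⟩
  have hxs : ∑ i, x i = 0 := (hW x).1 hx
  have hvs : ∑ i, v i = 0 := (hW v).1 hv
  have hx2 : ∑ i, x i ^ 2 = 1 := by
    rw [← EuclideanSpace.real_norm_sq_eq, hx1, one_pow]
  -- Modulo `Wᗮ`, the constant vectors, the terms in `B` and `G` disappear because `x` has zero sum.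
  obtain ⟨k, hk⟩ : ∃ k, ∀ i, A * (x i * x i) - η * x i = k := by
    refine ⟨A * (x o * x o) - η * x o, fun i => ?_⟩
    have := eq_of_mem_orthogonal (fun y hy => (hW y).2 hy) hxT i o
    simp only [PiLp.sub_apply, PiLp.smul_apply, smul_eq_mul, h.thirdDeriv_apply, hxs] at this
    linarith
  obtain ⟨l, hl⟩ : ∃ l, ∀ i, (2 * A * x i - η) * v i = l := by
    refine ⟨(2 * A * x o - η) * v o, fun i => ?_⟩
    have := eq_of_mem_orthogonal (fun y hy => (hW y).2 hy) hvT i o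
    simp only [PiLp.sub_apply, PiLp.smul_apply, smul_eq_mul, h.thirdMixed_apply, hxs, hvs] at this
    linarith
  have hη : η ≠ 0 := by
    rintro rfl
    have hsq : ∀ i, x i ^ 2 = k / A := fun i => by
      rw [eq_div_iff hA, ← hk i]
      ring
    have hz := eq_zero_of_sq_const_of_sum_eq_zero hd hsq hxs
    simp [hz] at hx2
  -- All `x i` are roots of one quadratic, and this is its discriminant. If it vanished, `x` would
  -- be constant and nonzero, against the zero sum.
  have hD : ∀ i, (2 * A * x i - η) ^ 2 = 4 * A * k + η ^ 2 := fun i => by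
    rw [← hk i]
    ring
  have hDpos : 4 * A * k + η ^ 2 ≠ 0 := by
    intro h0
    have hxi : ∀ i, 2 * A * x i = η := fun i => by
      have := pow_eq_zero_iff (two_ne_zero) |>.1 ((hD i).trans h0)
      linarith
    have : ∑ i, 2 * A * x i = 0 := by rw [← Finset.mul_sum, hxs, mul_zero]
    simp [hxi, hη, hd0] at this
  have hvD : ∀ i, (4 * A * k + η ^ 2) * v i = l * (2 * A * x i - η) := fun i => by
    rw [← hD i, ← hl i]
    ring
  -- Summing `hvD` over `i` leaves `-l d η = 0`.
  have hl0 : l = 0 := by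
    have hsum : ∑ i, l * (2 * A * x i - η) = 0 := by
      rw [← Finset.sum_congr rfl fun i _ => hvD i, ← Finset.mul_sum, hvs, mul_zero]
    rw [← Finset.mul_sum, Finset.sum_sub_distrib, ← Finset.mul_sum, hxs] at hsum
    simp [hη, hd.pos.ne'] at hsum
    exact hsum
  ext i
  have := hvD i
  rw [hl0, zero_mul] at this
  exact (mul_eq_zero.1 this).resolve_left hDpos

theorem propertyC (h : HasInvariantForm p a b A B G) (hd : Odd d)
    (hc : A + 3 * d * B + d ^ 2 * G ≠ 0) (hbA : 1 < d → b ≠ 0 ∧ A ≠ 0) : PropertyC p := by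
  rw [propertyC_iff]
  intro μ _ η x hx hx1 hxT v hv hvT
  by_cases hcase : 1 < d ∧ μ = a
  · obtain ⟨hd1, rfl⟩ := hcase
    exact h.eq_zero_of_sum_eq_zero hd (hbA hd1).2
      (fun y => h.mem_eigenspace_self_iff (hbA hd1).1 hd.pos) hx hx1 hxT hv hvT
  · refine h.eq_zero_of_const hc (fun y hy i j => ?_) hx hx1 hxT hv hvT
    by_cases hd1 : 1 < d
    · have hμ : μ - a ≠ 0 := sub_ne_zero.2 fun he => hcase ⟨hd1, he⟩
      have hy' := h.mem_eigenspace_iff.1 hy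
      exact mul_left_cancel₀ hμ (by linarith [hy' i, hy' j])
    · have : i = j := Fin.ext (by omega)
      rw [this]

theorem cubic_ne_zero (h : HasInvariantForm p a b A B G) (hd : 0 < d) (hp : PropertyC p) :
    A + 3 * d * B + d ^ 2 * G ≠ 0 := by
  intro hc
  refine hp.thirdDeriv_notMem_orthogonal (h.const_mem_eigenspace 1) (fun h0 => ?_) ?_
  · have := congrArg (fun v : EuclideanSpace ℝ (Fin d) => v ⟨0, hd⟩) h0
    simp at this
  · have : thirdDeriv p (WithLp.toLp 2 fun _ => 1) = 0 := by
      ext i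
      rw [h.thirdDeriv_apply]
      simp
      linarith
    rw [this]
    exact Submodule.zero_mem _

/-- If `A = 0`, the cubic form sends `e_0 - e_1` to a constant vector, orthogonal to the hyperplane.
-/
theorem coeff_ne_zero (h : HasInvariantForm p a b A B G) (hd : 1 < d) (hb : b ≠ 0)
    (hp : PropertyC p) : A ≠ 0 := by
  rintro rfl
  have hij : (⟨0, by omega⟩ : Fin d) ≠ ⟨1, hd⟩ := by simp
  have hmem := h.sub_single_mem_eigenspace ⟨0, by omega⟩ ⟨1, hd⟩
  refine hp.thirdDeriv_notMem_orthogonal hmem (single_sub_single_ne_zero hij) ?_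
  rw [Submodule.mem_orthogonal]
  intro y hy
  have hs := (h.mem_eigenspace_self_iff hb (by omega)).1 hmem
  have hys := (h.mem_eigenspace_self_iff hb (by omega)).1 hy
  rw [PiLp.inner_apply]
  simp only [h.thirdDeriv_apply, hs]
  simp [← Finset.mul_sum, hys]

theorem hasDistinctHessianEigenvalues_iff (h : HasInvariantForm p a b A B G) (hd : 1 < d) :
    HasDistinctHessianEigenvalues p ↔ b ≠ 0 := by
  constructor
  · rintro ⟨μ, ν, hne, hμ, hν⟩ rfl
    have key : ∀ μ, Module.End.HasEigenvalue (hessian p) μ → μ = a := by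
      intro μ hμ
      obtain ⟨x, hx, hx0⟩ := hμ.exists_hasEigenvector
      by_contra hne
      refine hx0 (PiLp.ext fun i => ?_)
      have := h.mem_eigenspace_iff.1 hx i
      have h2 : (μ - a) * x i = 0 := by linarith
      exact (mul_eq_zero.1 h2).resolve_left (sub_ne_zero.2 hne)
    exact hne ((key μ hμ).trans (key ν hν).symm)
  · intro hb
    refine ⟨a + d * b, a, ?_, ?_, ?_⟩
    · have : (d : ℝ) ≠ 0 := Nat.cast_ne_zero.2 (by omega)
      simp [hb, this]
    · refine Module.End.hasEigenvalue_of_hasEigenvector ⟨h.const_mem_eigenspace 1, fun h0 => ?_⟩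
      have := congrArg (fun v : EuclideanSpace ℝ (Fin d) => v ⟨0, by omega⟩) h0
      simp at this
    · exact Module.End.hasEigenvalue_of_hasEigenvector
        ⟨h.sub_single_mem_eigenspace ⟨0, by omega⟩ ⟨1, hd⟩, single_sub_single_ne_zero (by simp)⟩

theorem propertyC_and_distinct_iff (h : HasInvariantForm p a b A B G) (hd : Odd d) :
    (PropertyC p ∧ (1 < d → HasDistinctHessianEigenvalues p)) ↔
      A + 3 * d * B + d ^ 2 * G ≠ 0 ∧ (1 < d → b ≠ 0 ∧ A ≠ 0) := by
  constructor
  · rintro ⟨hp, hdis⟩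
    refine ⟨h.cubic_ne_zero hd.pos hp, fun hd1 => ?_⟩
    have hb := (h.hasDistinctHessianEigenvalues_iff hd1).1 (hdis hd1)
    exact ⟨hb, h.coeff_ne_zero hd1 hb hp⟩
  · rintro ⟨hc, hbA⟩
    exact ⟨h.propertyC hd hc hbA,
      fun hd1 => (h.hasDistinctHessianEigenvalues_iff hd1).2 (hbA hd1).1⟩

end HasInvariantForm

/-! ### Derivatives at the origin as continuous functionals -/

open Filter Topology

/-- An entry of the Hessian at the origin, as a linear functional. -/
noncomputable def secondCoeff (i j : Fin d) : MvPolynomial (Fin d) ℝ →ₗ[ℝ] ℝ where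
  toFun p := eval 0 (pderiv i (pderiv j p))
  map_add' p q := by simp only [map_add]
  map_smul' c p := by simp only [Derivation.map_smul, smul_eval, smul_eq_mul, RingHom.id_apply]

/-- An entry of the third derivative at the origin, as a linear functional. -/
noncomputable def thirdCoeff (i j k : Fin d) : MvPolynomial (Fin d) ℝ →ₗ[ℝ] ℝ where
  toFun p := eval 0 (pderiv i (pderiv j (pderiv k p)))
  map_add' p q := by simp only [map_add]
  map_smul' c p := by simp only [Derivation.map_smul, smul_eval, smul_eq_mul, RingHom.id_apply]

theorem continuous_coeff (m : ℕ) (s : Fin d →₀ ℕ) :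
    Continuous fun p : invariantPolys d m => coeff s (p : MvPolynomial (Fin d) ℝ) :=
  (continuous_apply s).comp continuous_induced_dom

theorem continuous_secondCoeff (m : ℕ) (i j : Fin d) :
    Continuous fun p : invariantPolys d m => secondCoeff i j p := by
  simp only [secondCoeff, LinearMap.coe_mk, AddHom.coe_mk, eval_zero, constantCoeff_eq,
    coeff_pderiv]
  exact ((continuous_coeff m _).mul continuous_const).mul continuous_const

theorem continuous_thirdCoeff (m : ℕ) (i j k : Fin d) :
    Continuous fun p : invariantPolys d m => thirdCoeff i j k p := by
  simp only [thirdCoeff, LinearMap.coe_mk, AddHom.coe_mk, eval_zero, constantCoeff_eq,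
    coeff_pderiv]
  exact (((continuous_coeff m _).mul continuous_const).mul continuous_const).mul continuous_const

theorem secondCoeff_perm {p : MvPolynomial (Fin d) ℝ} (hp : p.IsSymmetric)
    (σ : Equiv.Perm (Fin d)) (i j : Fin d) :
    secondCoeff (σ i) (σ j) p = secondCoeff i j p := by
  simp only [secondCoeff, LinearMap.coe_mk, AddHom.coe_mk]
  conv_lhs => rw [← hp σ]
  rw [pderiv_rename σ.injective, pderiv_rename σ.injective, eval_rename]
  rfl

theorem thirdCoeff_perm {p : MvPolynomial (Fin d) ℝ} (hp : p.IsSymmetric)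
    (σ : Equiv.Perm (Fin d)) (i j k : Fin d) :
    thirdCoeff (σ i) (σ j) (σ k) p = thirdCoeff i j k p := by
  simp only [thirdCoeff, LinearMap.coe_mk, AddHom.coe_mk]
  conv_lhs => rw [← hp σ]
  rw [pderiv_rename σ.injective, pderiv_rename σ.injective, pderiv_rename σ.injective, eval_rename]
  rfl

/-- By this multiple transitivity, derivatives of an invariant polynomial depend only on which
indices coincide. -/
theorem exists_perm_of_injective {n : ℕ} {f g : Fin n → Fin d} (hf : Function.Injective f)
    (hg : Function.Injective g) : ∃ σ : Equiv.Perm (Fin d), ∀ i, σ (f i) = g i := by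
  have := Equiv.Perm.isMultiplyPretransitive (Fin d) n
  obtain ⟨σ, hσ⟩ := MulAction.exists_smul_eq (Equiv.Perm (Fin d))
    (⟨f, hf⟩ : Fin n ↪ Fin d) ⟨g, hg⟩
  exact ⟨σ, fun i => DFunLike.congr_fun hσ i⟩

theorem exists_perm_pair {i j i' j' : Fin d} (h : i ≠ j) (h' : i' ≠ j') :
    ∃ σ : Equiv.Perm (Fin d), σ i = i' ∧ σ j = j' := by
  obtain ⟨σ, hσ⟩ := exists_perm_of_injective (f := ![i, j]) (g := ![i', j'])
    (by intro a b; fin_cases a <;> fin_cases b <;> simp [h, h.symm])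
    (by intro a b; fin_cases a <;> fin_cases b <;> simp [h', h'.symm])
  exact ⟨σ, hσ 0, hσ 1⟩

theorem exists_perm_triple {i j k i' j' k' : Fin d} (hij : i ≠ j) (hik : i ≠ k) (hjk : j ≠ k)
    (hij' : i' ≠ j') (hik' : i' ≠ k') (hjk' : j' ≠ k') :
    ∃ σ : Equiv.Perm (Fin d), σ i = i' ∧ σ j = j' ∧ σ k = k' := by
  obtain ⟨σ, hσ⟩ := exists_perm_of_injective (f := ![i, j, k]) (g := ![i', j', k'])
    (by intro a b; fin_cases a <;> fin_cases b <;>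
          simp [hij, hik, hjk, hij.symm, hik.symm, hjk.symm])
    (by intro a b; fin_cases a <;> fin_cases b <;>
          simp [hij', hik', hjk', hij'.symm, hik'.symm, hjk'.symm])
  exact ⟨σ, hσ 0, hσ 1, hσ 2⟩

/-- The coefficients of the invariant form depend linearly and continuously on the polynomial. -/
theorem exists_invariantForm (m : ℕ) (hd : Odd d) :
    ∃ a b A B G : MvPolynomial (Fin d) ℝ →ₗ[ℝ] ℝ,
      (Continuous fun p : invariantPolys d m => b p) ∧
      (Continuous fun p : invariantPolys d m => A p) ∧
      (Continuous fun p : invariantPolys d m => B p) ∧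
      (Continuous fun p : invariantPolys d m => G p) ∧
      ∀ p : MvPolynomial (Fin d) ℝ, p.IsSymmetric →
        HasInvariantForm p (a p) (b p) (A p) (B p) (G p) := by
  rcases Nat.lt_or_ge 1 d with hd1 | hd1
  · have hd3 : 2 < d := by
      obtain ⟨r, rfl⟩ := hd
      omega
    let u : Fin d := ⟨0, by omega⟩
    let v : Fin d := ⟨1, by omega⟩
    let w : Fin d := ⟨2, hd3⟩
    have huv : u ≠ v := by simp [u, v]
    have huw : u ≠ w := by simp [u, w]
    have hvw : v ≠ w := by simp [v, w]
    have c1 := continuous_thirdCoeff m u u u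
    have c2 := continuous_thirdCoeff m u u v
    have c3 := continuous_thirdCoeff m u v w
    -- These invert `T_uuu = A + 3B + G`, `T_uuv = B + G`, `T_uvw = G`; three distinct indices exist
    -- as `d` is odd and exceeds 1.
    refine ⟨secondCoeff u u - secondCoeff u v, secondCoeff u v,
      thirdCoeff u u u - (3 : ℝ) • thirdCoeff u u v + (2 : ℝ) • thirdCoeff u v w,
      thirdCoeff u u v - thirdCoeff u v w, thirdCoeff u v w, continuous_secondCoeff m u v,
      (c1.sub (c2.const_smul (3 : ℝ))).add (c3.const_smul (2 : ℝ)), c2.sub c3, c3,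
      fun p hp => ⟨fun i j => ?_, fun i j k => ?_⟩⟩
    · change secondCoeff i j p = _
      by_cases hij : i = j
      · subst hij
        have := secondCoeff_perm hp (Equiv.swap u i) u u
        simp only [Equiv.swap_apply_left] at this
        simp [this]
      · obtain ⟨σ, rfl, rfl⟩ := exists_perm_pair huv hij
        simp [secondCoeff_perm hp, huv]
    · have h1 : ∀ i, thirdCoeff i i i p = thirdCoeff u u u p := fun i => by
        simpa only [Equiv.swap_apply_left] using thirdCoeff_perm hp (Equiv.swap u i) u u u
      have h2 : ∀ i k, i ≠ k → thirdCoeff i i k p = thirdCoeff u u v p := fun i k hik => by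
        obtain ⟨σ, rfl, rfl⟩ := exists_perm_pair huv hik
        exact thirdCoeff_perm hp σ u u v
      have h3 : ∀ i j k, thirdCoeff i j k p = thirdCoeff i k j p := fun i j k => by
        simp only [thirdCoeff, LinearMap.coe_mk, AddHom.coe_mk, pderiv_comm j k]
      have h4 : ∀ i j k, thirdCoeff i j k p = thirdCoeff j i k p := fun i j k => by
        simp only [thirdCoeff, LinearMap.coe_mk, AddHom.coe_mk, pderiv_comm i j]
      change thirdCoeff i j k p = _
      simp only [LinearMap.add_apply, LinearMap.sub_apply, LinearMap.smul_apply, smul_eq_mul]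
      by_cases hij : i = j
      · subst hij
        by_cases hik : i = k
        · subst hik
          rw [h1]
          simp
          ring
        · rw [h2 i k hik]
          simp [hik]
      · by_cases hik : i = k
        · subst hik
          rw [h3, h2 i j hij]
          simp [hij, Ne.symm hij]
        · by_cases hjk : j = k
          · subst hjk
            rw [h4, h3, h2 j i (Ne.symm hij)]
            simp [hij]
          · obtain ⟨σ, rfl, rfl, rfl⟩ := exists_perm_triple huv huw hvw hij hik hjk
            rw [thirdCoeff_perm hp]
            simp [huv, huw, hvw]
  · obtain rfl : d = 1 := by
      have := hd.pos
      omega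
    refine ⟨secondCoeff 0 0, 0, thirdCoeff 0 0 0, 0, 0, continuous_const,
      continuous_thirdCoeff m 0 0 0, continuous_const, continuous_const,
      fun p _ => ⟨fun i j => ?_, fun i j k => ?_⟩⟩
    · fin_cases i; fin_cases j
      simp [secondCoeff]
    · fin_cases i; fin_cases j; fin_cases k
      simp [thirdCoeff]

/-! ### The polynomial `h_d` -/

theorem witness_eq (d : ℕ) : witness d =
    C (1 / 2) * ((∑ i, X i) ^ 2 - ∑ i, X i ^ 2) + C (1 / 3) * ∑ i, X i ^ 3 := by
  have hsq : (∑ i : Fin d, X i) ^ 2 =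
      ∑ i, (X i : MvPolynomial (Fin d) ℝ) ^ 2 + 2 * ∑ i, ∑ j ∈ Finset.Ioi i, X i * X j := by
    have h := Finset.sum_sum_Ioi_add_eq_sum_sum_off_diag
      fun i j : Fin d => (X i * X j : MvPolynomial (Fin d) ℝ)
    have h1 : ∀ i : Fin d, ∑ j ∈ Finset.Ioi i, (X j * X i + X i * X j) =
        2 * ∑ j ∈ Finset.Ioi i, (X i * X j : MvPolynomial (Fin d) ℝ) := fun i => by
      rw [Finset.mul_sum]
      exact Finset.sum_congr rfl fun j _ => by ring
    rw [Finset.sum_congr rfl fun i _ => h1 i, ← Finset.mul_sum] at h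
    rw [h, sq, Finset.sum_mul_sum, ← Finset.sum_add_distrib]
    refine Finset.sum_congr rfl fun i _ => ?_
    rw [Fintype.sum_eq_add_sum_compl i, sq]
    exact congrArg _ (Finset.sum_congr rfl fun j _ => mul_comm _ _)
  have h2 : (C (1 / 2) : MvPolynomial (Fin d) ℝ) * 2 = 1 := by
    rw [show (2 : MvPolynomial (Fin d) ℝ) = C 2 from rfl, ← C_mul]
    norm_num
  rw [witness, hsq, add_sub_cancel_left, ← mul_assoc, h2, one_mul]

theorem pderiv_witness (i : Fin d) : pderiv i (witness d) = ∑ j, X j - X i + X i ^ 2 := by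
  have hC : ∀ (n : ℕ) (hn : n ≠ 0), (C (1 / (n : ℝ)) : MvPolynomial (Fin d) ℝ) * n = 1 := by
    intro n hn
    rw [← C_eq_coe_nat, ← C_mul, one_div, inv_mul_cancel₀ (Nat.cast_ne_zero.2 hn), C_1]
  have h2 := hC 2 two_ne_zero
  have h3 := hC 3 three_ne_zero
  push_cast at h2 h3
  rw [witness_eq]
  simp only [map_add, map_sub, map_sum, pderiv_C_mul, pderiv_pow, pderiv_X, Pi.single_apply,
    mul_ite, mul_one, mul_zero, Finset.sum_ite_eq', Finset.mem_univ, if_true]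
  push_cast
  simp only [pow_one]
  linear_combination (∑ j, X j - X i) * h2 + X i ^ 2 * h3

theorem hasInvariantForm_witness (d : ℕ) : HasInvariantForm (witness d) (-1) 1 2 0 0 := by
  have h2 : ∀ i j : Fin d, pderiv i (pderiv j (witness d)) =
      1 - (if i = j then 1 else 0) + (if i = j then 2 * X j else 0) := by
    intro i j
    rw [pderiv_witness]
    by_cases h : i = j
    · subst h
      simp [pderiv_X, Pi.single_apply]
    · simp [pderiv_X, Pi.single_apply, h, Ne.symm h]
  refine ⟨fun i j => ?_, fun i j k => ?_⟩
  · rw [h2]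
    split_ifs <;> simp
  · rw [h2]
    by_cases h : j = k
    · subst h
      by_cases hij : i = j
      · subst hij
        simp [show (2 : MvPolynomial (Fin d) ℝ) = C 2 from rfl]
      · simp [show (2 : MvPolynomial (Fin d) ℝ) = C 2 from rfl, pderiv_X, hij, Ne.symm hij]
    · by_cases hij : i = j
      · subst hij
        simp [h]
      · simp [h, hij]

theorem witness_mem_invariantPolys (d : ℕ) {m : ℕ} (hm : 3 ≤ m) :
    witness d ∈ invariantPolys d m := by
  refine ⟨le_trans ?_ hm, fun σ => ?_, ?_, fun i => ?_⟩
  · have hX : ∀ (i : Fin d) (n : ℕ), (X i ^ n : MvPolynomial (Fin d) ℝ).totalDegree ≤ n :=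
      fun i n => (totalDegree_X_pow i n).le
    refine (totalDegree_add _ _).trans (max_le ?_ ?_)
    · refine totalDegree_finsetSum_le fun i _ => totalDegree_finsetSum_le fun j _ => ?_
      refine (totalDegree_mul _ _).trans ?_
      simp
    · refine (totalDegree_mul _ _).trans ?_
      rw [totalDegree_C, zero_add]
      exact totalDegree_finsetSum_le fun i _ => hX i 3
  · rw [witness_eq]
    simp only [map_add, map_mul, map_sub, map_pow, map_sum, rename_C, rename_X]
    rw [Equiv.sum_comp σ (fun i => (X i : MvPolynomial (Fin d) ℝ)),
      Equiv.sum_comp σ (fun i => (X i : MvPolynomial (Fin d) ℝ) ^ 2),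
      Equiv.sum_comp σ (fun i => (X i : MvPolynomial (Fin d) ℝ) ^ 3)]
  · simp [witness]
  · rw [pderiv_witness]
    simp

/-! ### Perturbation along a line, and the theorem -/

theorem continuous_add_smul {m : ℕ} (p h : invariantPolys d m) :
    Continuous fun t : ℝ => p + t • h := by
  refine continuous_induced_rng.2 (continuous_pi fun s => ?_)
  simp only [Function.comp_apply, Submodule.coe_add, Submodule.coe_smul, coeff_add, coeff_smul]
  fun_prop

/-- `f p + t * f h` is affine in `t` with nonzero slope, so its only root can be avoided near `0`.
-/
theorem eventually_linearMap_ne_zero {m : ℕ} (f : MvPolynomial (Fin d) ℝ →ₗ[ℝ] ℝ)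
    (p h : invariantPolys d m) (hf : f h ≠ 0) :
    ∀ᶠ t in 𝓝[≠] (0 : ℝ), f (p + t • h : invariantPolys d m) ≠ 0 := by
  simp only [Submodule.coe_add, Submodule.coe_smul, map_add, map_smul, smul_eq_mul]
  by_cases hp : f p = 0
  · filter_upwards [self_mem_nhdsWithin] with t ht
    rw [hp, zero_add]
    exact mul_ne_zero ht hf
  · have hc : Continuous fun t : ℝ => f p + t * f h := by fun_prop
    exact nhdsWithin_le_nhds (hc.continuousAt.eventually_ne (by simpa using hp))

end TangencyPropC

theorem mainTheorem12 (d m : ℕ) (hd : Odd d) (hm : 3 ≤ m) :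
    IsOpen {p : TangencyPropC.invariantPolys d m |
      TangencyPropC.PropertyC (p : MvPolynomial (Fin d) ℝ) ∧
        (1 < d → TangencyPropC.HasDistinctHessianEigenvalues (p : MvPolynomial (Fin d) ℝ))} ∧
    Dense {p : TangencyPropC.invariantPolys d m |
      TangencyPropC.PropertyC (p : MvPolynomial (Fin d) ℝ) ∧
        (1 < d → TangencyPropC.HasDistinctHessianEigenvalues (p : MvPolynomial (Fin d) ℝ))} ∧
    TangencyPropC.witness d ∈ TangencyPropC.invariantPolys d m ∧
    TangencyPropC.PropertyC (TangencyPropC.witness d) := by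
  open TangencyPropC Filter Topology in
  obtain ⟨a, b, A, B, G, hb, hA, hB, hG, hform⟩ := exists_invariantForm m hd
  have hw := witness_mem_invariantPolys d hm
  have hwform := (hasInvariantForm_witness d).propertyC_and_distinct_iff hd
  have hwC := hwform.2 ⟨by norm_num, fun _ => ⟨by norm_num, by norm_num⟩⟩
  have hiff := fun p : invariantPolys d m => (hform p p.2.2.1).propertyC_and_distinct_iff hd
  -- Read in this direction, the criterion shows that the abstract functionals are nonzero at `h_d`
  -- without computing them.
  have hcrit := (hiff ⟨witness d, hw⟩).1 hwC
  simp only [hiff]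
  refine ⟨?_, ?_, hw, hwC.1⟩
  · refine IsOpen.and ?_ ?_
    · exact isOpen_ne_fun ((hA.add (continuous_const.mul hB)).add (continuous_const.mul hG))
        continuous_const
    · by_cases hd1 : 1 < d
      · simp only [hd1, forall_const]
        exact (isOpen_ne_fun hb continuous_const).and (isOpen_ne_fun hA continuous_const)
      · simp [hd1]
  · intro p
    have htend : Tendsto (fun t : ℝ => p + t • (⟨witness d, hw⟩ : invariantPolys d m))
        (𝓝[≠] 0) (𝓝 p) := by
      have := (continuous_add_smul p ⟨witness d, hw⟩).tendsto 0
      rw [zero_smul, add_zero] at this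
      exact this.mono_left nhdsWithin_le_nhds
    refine mem_closure_of_tendsto htend ?_
    have hc := eventually_linearMap_ne_zero (A + (3 * d : ℝ) • B + (d ^ 2 : ℝ) • G) p
      ⟨witness d, hw⟩ hcrit.1
    by_cases hd1 : 1 < d
    · filter_upwards [hc, eventually_linearMap_ne_zero b p _ (hcrit.2 hd1).1,
        eventually_linearMap_ne_zero A p _ (hcrit.2 hd1).2] with t h1 h2 h3
      exact ⟨h1, fun _ => ⟨h2, h3⟩⟩
    · filter_upwards [hc] with t h1
      exact ⟨h1, fun h => absurd h hd1⟩
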